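/- Let $R$ be a commutative ring and $X,Y\in R$ (for instance two indeterminates over $\mathbb Z$, or two real numbers). The Model I associated Laguerre polynomials $L_n(x)=L_n(x;X,Y)\in R[x]$ are defined by $L_{-1}=0$, $L_0=1$ and $$L_{n+1}(x)=(x-b_n)L_n(x)-\lambda_nL_{n-1}(x),\qquad b_n=2n+X+Y,\quad \lambda_n=(n+X)(n+Y-1).$$ A permutation tableau is a filling with 0's and 1's of a Ferrers diagram (empty rows are allowed) such that each column contains at least one 1 and no 0 has both a 1 above it in its column and a 1 to the left of it in its row. Its length is its number of rows plus its number of columns, and $\mathrm{PT}_n$ is the set of permutation tableaux of length $n$. Let $\mathrm{urr}(T)$ be the number of unrestricted rows of $T$, that is, rows in which no 0 has a 1 above it in its column, and let $\mathrm{urc}(T)$ be the number of unrestricted columns of $T$, that is, columns in which no 0 has a 1 to the left of it in its row. **Theorem 4.1.** There is an $R$-linear functional $\mathcal L\colon R[x]\to R$ with $\mathcal L(1)=1$ and $\mathcal L(L_kL_m)=0$ for all $k\ne m$, and for every such functional the moments $\mu_n=\mathcal L(x^n)$ are $$\mu_n=\sum_{T\in\mathrm{PT}_{n+1}}X^{\mathrm{urr}(T)-1}\,Y^{\mathrm{urc}(T)}\qquad(n\ge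 0).$$ In particular, if $X,Y$ are real and $\nu$ is a probability measure on $\mathbb R$ with finite moments of all orders for which $\int L_kL_m\,d\nu=0$ whenever $k\neq m$, then $\int x^n\,d\nu$ equals the same sum for every $n\ge0$. -/

import Mathlib

/-- The monic polynomials given by the three term recurrence
`p_{n+1}(x) = (x - b_n) p_n(x) - lam_n p_{n-1}(x)`, `p_0 = 1`, `p_{-1} = 0`. -/
noncomputable def recurrencePoly {R : Type*} [CommRing R] (b lam : ℕ → R) : ℕ → Polynomial R
  | 0 => 1
  | 1 => Polynomial.X - Polynomial.C (b 0)
  | n + 2 => (Polynomial.X - Polynomial.C (b (n + 1))) * recurrencePoly b lam (n + 1)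
      - Polynomial.C (lam (n + 1)) * recurrencePoly b lam n

/-- The (Model I) associated Laguerre polynomials `L_n(x; X, Y)`:
`b_n = 2n + X + Y` and `lam_n = (n + X)(n + Y - 1)`. -/
noncomputable def assocLaguerre {R : Type*} [CommRing R] (X Y : R) : ℕ → Polynomial R :=
  recurrencePoly (fun n => 2 * (n : R) + X + Y) (fun n => ((n : R) + X) * ((n : R) + Y - 1))

/-- `L` is a normalized moment functional of the polynomials `p_n`: `L(1) = 1` and the `p_n` are
pairwise orthogonal with respect to `L`. The `n`-th moment is then `L(x^n)`. -/
def IsMomentFunctional {R : Type*} [CommRing R] (p : ℕ → Polynomial R)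
    (L : Polynomial R →ₗ[R] R) : Prop :=
  L 1 = 1 ∧ ∀ m n : ℕ, m ≠ n → L (p m * p n) = 0

/-- A permutation tableau. The Ferrers diagram, which may have empty rows at the bottom, is a Young
diagram together with a number of rows that is at least the number of its nonempty rows.
A cell is `(i, j)` with `i` the row, counted from the top, and `j` the column, counted from
the left. The filling is given by the set of the cells that contain a 1; the other cells of the
diagram contain a 0. -/
@[ext]
structure PermutationTableau where
  /-- the nonempty part of the Ferrers diagram -/
  shape : YoungDiagram
  /-- the number of rows, empty rows included -/
  numRows : ℕ
  colLen_le : shape.colLen 0 ≤ numRows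
  /-- the cells that contain a 1 -/
  ones : Finset (ℕ × ℕ)
  ones_subset : ones ⊆ shape.cells
  /-- each column contains at least one 1 -/
  exists_one : ∀ j < shape.rowLen 0, ∃ i, (i, j) ∈ ones
  /-- no 0 has both a 1 above it in its column and a 1 to the left of it in its row -/
  not_above_and_left : ∀ i j, (i, j) ∈ shape → (i, j) ∉ ones →
    ¬ ((∃ i' < i, (i', j) ∈ ones) ∧ ∃ j' < j, (i, j') ∈ ones)

namespace PermutationTableau

/-- The number of columns. -/
def numCols (T : PermutationTableau) : ℕ := T.shape.rowLen 0

/-- The length: the number of rows plus the number of columns. -/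
def length (T : PermutationTableau) : ℕ := T.numRows + T.numCols

/-- The cell `(i, j)` contains a 0 with a 1 above it in the same column. -/
def IsRestrictedZero (T : PermutationTableau) (i j : ℕ) : Prop :=
  (i, j) ∈ T.shape ∧ (i, j) ∉ T.ones ∧ ∃ i' < i, (i', j) ∈ T.ones

/-- The cell `(i, j)` contains a 0 with a 1 to the left of it in the same row. -/
def IsCRestrictedZero (T : PermutationTableau) (i j : ℕ) : Prop :=
  (i, j) ∈ T.shape ∧ (i, j) ∉ T.ones ∧ ∃ j' < j, (i, j') ∈ T.ones

open Classical in
/-- The number of unrestricted rows: the rows without a restricted 0. -/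
noncomputable def urr (T : PermutationTableau) : ℕ :=
  ((Finset.range T.numRows).filter fun i => ¬ ∃ j, T.IsRestrictedZero i j).card

open Classical in
/-- The number of unrestricted columns: the columns without a c-restricted 0. -/
noncomputable def urc (T : PermutationTableau) : ℕ :=
  ((Finset.range T.numCols).filter fun j => ¬ ∃ i, T.IsCRestrictedZero i j).card

theorem finite_length_eq (n : ℕ) : {T : PermutationTableau | T.length = n}.Finite := by
  let S : Finset (ℕ × ℕ) := Finset.range n ×ˢ Finset.range n
  refine Set.Finite.of_finite_image
    (f := fun T : PermutationTableau => (T.shape.cells, T.numRows, T.ones)) ?_ ?_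
  · refine Set.Finite.subset (S.powerset ×ˢ (Finset.range (n + 1) ×ˢ S.powerset)).finite_toSet ?_
    rintro _ ⟨T, hT, rfl⟩
    have hlen : T.numRows + T.shape.rowLen 0 = n := hT
    have hsub : T.shape.cells ⊆ S := by
      rintro ⟨i, j⟩ hc
      have hc' : (i, j) ∈ T.shape := hc
      have h1 : j < T.shape.rowLen 0 := YoungDiagram.mem_iff_lt_rowLen.1
        (T.shape.up_left_mem (Nat.zero_le i) le_rfl hc')
      have h2 : i < T.shape.colLen 0 := YoungDiagram.mem_iff_lt_colLen.1
        (T.shape.up_left_mem le_rfl (Nat.zero_le j) hc')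
      have h3 := T.colLen_le
      simp only [S, Finset.mem_product, Finset.mem_range]
      omega
    simp only [Finset.coe_product, Set.mem_prod, Finset.mem_coe, Finset.mem_powerset,
      Finset.mem_range]
    exact ⟨hsub, by omega, T.ones_subset.trans hsub⟩
  · intro T _ T' _ h
    simp only [Prod.mk.injEq] at h
    exact PermutationTableau.ext (YoungDiagram.ext h.1) h.2.1 h.2.2

/-- The finite set of the permutation tableaux of length `n`. -/
noncomputable def PT (n : ℕ) : Finset PermutationTableau := (finite_length_eq n).toFinset

theorem mem_PT {n : ℕ} {T : PermutationTableau} : T ∈ PT n ↔ T.length = n := by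
  simp [PT]

/-- The top row is unrestricted, so the exponent `urr T - 1` is never truncated. -/
theorem one_le_urr {n : ℕ} {T : PermutationTableau} (hT : T ∈ PT (n + 1)) : 1 ≤ T.urr := by
  have hlen : T.numRows + T.shape.rowLen 0 = n + 1 := mem_PT.1 hT
  have hpos : 0 < T.numRows := by
    by_contra h0
    have h1 : (0, 0) ∈ T.shape := YoungDiagram.mem_iff_lt_rowLen.2 (by omega)
    have h2 := YoungDiagram.mem_iff_lt_colLen.1 h1
    have h3 := T.colLen_le
    omega
  classical
  refine Finset.card_pos.2 ⟨0, Finset.mem_filter.2 ⟨Finset.mem_range.2 hpos, ?_⟩⟩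
  rintro ⟨j, -, -, i', hi', -⟩
  exact absurd hi' (Nat.not_lt_zero i')

end PermutationTableau

/-! ### Moment functionals of three-term recurrences, and an operator model for the Laguerre case.
-/

section Functional

variable {R : Type*} [CommRing R]

/-! Write z for the variable of an auxiliary polynomial ring and x, y for the two parameters. Let D
send p(z) to ((z + y)(z + 1 + x) p(z + 1) - (y - 1) x p(0)) / (z + 1); the numerator vanishes at z =
-1. Let F be the linear map with F(1) = 1 under which multiplication by the variable becomes D. The
Laguerre recurrence then gives F(L_n) = z(z - 1)...(z - n + 1). Evaluating at z = 0 kills every L_n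
with n ≥ 1, so p ↦ F(p)(0) is a moment functional (`exists_isMomentFunctional_assocLaguerre`). The
recurrence alone determines the moments (`IsMomentFunctional.map_pow_unique`), so it remains to find
F(x^n)(0).

Tableaux realise D. Each tableau gets a polynomial `weight` whose value at 0 is its monomial; it is
built from the unrestricted rows, each marked with the number of unrestricted columns whose topmost
1 lies in it. A tableau of length n + 2 arises from one of length n + 1 in exactly one of two ways:
by an empty last row, which multiplies the weight by z + x, or by a first column of full length
whose ones form a nonempty set S of unrestricted rows. The sum of all resulting weights is D of the
old weight (`X_add_one_mul_addColSum`), by induction on the rows. Hence the weights of length n + 1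
sum to F(x^n). -/

open Polynomial in
theorem X_mul_recurrencePoly_succ (b lam : ℕ → R) (n : ℕ) :
    X * recurrencePoly b lam (n + 1) = recurrencePoly b lam (n + 2)
      + C (b (n + 1)) * recurrencePoly b lam (n + 1) + C (lam (n + 1)) * recurrencePoly b lam n := by
  rw [recurrencePoly]; ring

open Polynomial in
theorem X_mul_recurrencePoly_zero (b lam : ℕ → R) :
    X * recurrencePoly b lam 0 = recurrencePoly b lam 1 + C (b 0) * recurrencePoly b lam 0 := by
  simp [recurrencePoly]

theorem map_C_mul_eq (L : Polynomial R →ₗ[R] R) (c : R) (p : Polynomial R) :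
    L (Polynomial.C c * p) = c * L p := by
  rw [← Polynomial.smul_eq_C_mul, map_smul, smul_eq_mul]

/-- A functional that vanishes on `p_n` for `n ≥ 1` makes the `p_n` orthogonal. -/
theorem map_recurrencePoly_mul_eq_zero {b lam : ℕ → R} {L : Polynomial R →ₗ[R] R}
    (h : ∀ n, L (recurrencePoly b lam (n + 1)) = 0) (m : ℕ) :
    ∀ n, m < n → L (recurrencePoly b lam m * recurrencePoly b lam n) = 0 := by
  -- Expanding x p_{m-1} p_n by the recurrence of either factor expresses p_m p_n through products
  -- whose first index is smaller than m and still below the second. Nothing is divided by `lam`.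
  induction m using Nat.strong_induction_on with
  | _ m ih =>
    intro n hn
    obtain ⟨n, rfl⟩ : ∃ k, n = k + 1 := ⟨n - 1, by omega⟩
    match m, ih, hn with
    | 0, _, _ => simpa [recurrencePoly] using h n
    | 1, ih, hn =>
      have e : recurrencePoly b lam 1 * recurrencePoly b lam (n + 1)
          = recurrencePoly b lam 0 * recurrencePoly b lam (n + 2)
          + Polynomial.C (b (n + 1)) * (recurrencePoly b lam 0 * recurrencePoly b lam (n + 1))
          + Polynomial.C (lam (n + 1)) * (recurrencePoly b lam 0 * recurrencePoly b lam n)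
          - Polynomial.C (b 0) * (recurrencePoly b lam 0 * recurrencePoly b lam (n + 1)) := by
        linear_combination recurrencePoly b lam 0 * X_mul_recurrencePoly_succ b lam n
          - recurrencePoly b lam (n + 1) * X_mul_recurrencePoly_zero b lam
      rw [e]
      simp [map_C_mul_eq, ih 0 (by omega) (n + 2) (by omega), ih 0 (by omega) (n + 1) (by omega),
        ih 0 (by omega) n (by omega)]
    | m + 2, ih, hn =>
      have e : recurrencePoly b lam (m + 2) * recurrencePoly b lam (n + 1)
          = recurrencePoly b lam (m + 1) * recurrencePoly b lam (n + 2)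
          + Polynomial.C (b (n + 1)) * (recurrencePoly b lam (m + 1) * recurrencePoly b lam (n + 1))
          + Polynomial.C (lam (n + 1)) * (recurrencePoly b lam (m + 1) * recurrencePoly b lam n)
          - Polynomial.C (b (m + 1)) * (recurrencePoly b lam (m + 1) * recurrencePoly b lam (n + 1))
          - Polynomial.C (lam (m + 1)) * (recurrencePoly b lam m * recurrencePoly b lam (n + 1)) := by
        linear_combination recurrencePoly b lam (m + 1) * X_mul_recurrencePoly_succ b lam n
          - recurrencePoly b lam (n + 1) * X_mul_recurrencePoly_succ b lam m
      rw [e]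
      simp [map_C_mul_eq, ih (m + 1) (by omega) (n + 2) (by omega),
        ih (m + 1) (by omega) (n + 1) (by omega), ih (m + 1) (by omega) n (by omega),
        ih m (by omega) (n + 1) (by omega)]

theorem isMomentFunctional_recurrencePoly {b lam : ℕ → R} {L : Polynomial R →ₗ[R] R}
    (h1 : L 1 = 1) (h : ∀ n, L (recurrencePoly b lam (n + 1)) = 0) :
    IsMomentFunctional (recurrencePoly b lam) L := by
  refine ⟨h1, fun m n hmn => ?_⟩
  rcases lt_or_gt_of_ne hmn with hlt | hlt
  · exact map_recurrencePoly_mul_eq_zero h m n hlt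
  · rw [mul_comm]
    exact map_recurrencePoly_mul_eq_zero h n m hlt

theorem IsMomentFunctional.map_succ {b lam : ℕ → R} {L : Polynomial R →ₗ[R] R}
    (hL : IsMomentFunctional (recurrencePoly b lam) L) (n : ℕ) :
    L (recurrencePoly b lam (n + 1)) = 0 := by
  simpa [recurrencePoly] using hL.2 0 (n + 1) (by omega)

/-- The recurrence trades each factor `X` for a change of index, down to the values on the p_n
themselves, which are 1 for n = 0 and 0 otherwise. -/
theorem IsMomentFunctional.map_pow_unique {b lam : ℕ → R} {L L' : Polynomial R →ₗ[R] R}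
    (hL : IsMomentFunctional (recurrencePoly b lam) L)
    (hL' : IsMomentFunctional (recurrencePoly b lam) L') (j : ℕ) :
    L (Polynomial.X ^ j) = L' (Polynomial.X ^ j) := by
  suffices h : ∀ n, L (Polynomial.X ^ j * recurrencePoly b lam n)
      = L' (Polynomial.X ^ j * recurrencePoly b lam n) by
    simpa [recurrencePoly] using h 0
  induction j with
  | zero =>
    rintro (_ | n)
    · simp [recurrencePoly, hL.1, hL'.1]
    · simp [hL.map_succ, hL'.map_succ]
  | succ j ih =>
    rintro (_ | n)
    · have e : Polynomial.X ^ (j + 1) * recurrencePoly b lam 0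
          = Polynomial.X ^ j * recurrencePoly b lam 1
          + Polynomial.C (b 0) * (Polynomial.X ^ j * recurrencePoly b lam 0) := by
        linear_combination Polynomial.X ^ j * X_mul_recurrencePoly_zero b lam
      rw [e]
      simp only [map_add, map_C_mul_eq, ih]
    · have e : Polynomial.X ^ (j + 1) * recurrencePoly b lam (n + 1)
          = Polynomial.X ^ j * recurrencePoly b lam (n + 2)
          + Polynomial.C (b (n + 1)) * (Polynomial.X ^ j * recurrencePoly b lam (n + 1))
          + Polynomial.C (lam (n + 1)) * (Polynomial.X ^ j * recurrencePoly b lam n) := by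
        linear_combination Polynomial.X ^ j * X_mul_recurrencePoly_succ b lam n
      rw [e]
      simp only [map_add, map_C_mul_eq, ih]

open Polynomial in
/-- If the polynomials `A n` arise from `A 0 = 1` by the operator
`p(z) ↦ ((z + Y) (z + 1 + X) p(z + 1) - (Y - 1) X p(0)) / (z + 1)`, then the values `A n (0)` are
the moments of the associated Laguerre polynomials. -/
theorem exists_isMomentFunctional_assocLaguerre (x y : R) {A : ℕ → R[X]} (h0 : A 0 = 1)
    (hA : ∀ n, (X + 1) * A (n + 1) = (X + C y) * (X + 1 + C x) * (A n).comp (X + 1)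
      - C ((y - 1) * x * (A n).eval 0)) :
    ∃ L : R[X] →ₗ[R] R, IsMomentFunctional (assocLaguerre x y) L ∧
      ∀ n, L (X ^ n) = (A n).eval 0 := by
  let F : R[X] →ₗ[R] R[X] := (Polynomial.basisMonomials R).constr R A
  have hF : ∀ n, F (X ^ n) = A n := fun n => by
    have := (Polynomial.basisMonomials R).constr_basis R A n
    simpa [F, Polynomial.coe_basisMonomials, Polynomial.monomial_one_right_eq_X_pow] using this
  have hmul : ∀ p, (X + 1) * F (X * p) = (X + C y) * (X + 1 + C x) * (F p).comp (X + 1)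
      - C ((y - 1) * x * (F p).eval 0) := by
    intro p
    induction p using Polynomial.induction_on' with
    | add p q hp hq =>
      rw [mul_add, map_add, mul_add, hp, hq, map_add, add_comp, eval_add]
      simp only [map_mul, map_add]
      ring
    | monomial n c =>
      have e : F (X * monomial n c) = C c * A (n + 1) := by
        rw [← C_mul_X_pow_eq_monomial, ← hF, ← smul_eq_C_mul, ← smul_eq_C_mul, ← map_smul,
          pow_succ', mul_smul_comm]
      have e' : F (monomial n c) = C c * A n := by
        rw [← C_mul_X_pow_eq_monomial, ← hF, ← smul_eq_C_mul, ← smul_eq_C_mul, ← map_smul]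
      rw [e, e', mul_left_comm, hA, mul_comp, C_comp, eval_mul, eval_C]
      simp only [map_mul]
      ring
  -- Being monic, `X + 1` can be cancelled even when `R` has zero divisors.
  have hreg : ∀ {p q : R[X]}, (X + 1) * p = (X + 1) * q → p = q := by
    intro p q h
    have hm : (X + C (1 : R)).Monic := monic_X_add_C 1
    rw [map_one] at hm
    exact hm.isRegular.left h
  have hdesc : ∀ n, (descPochhammer R (n + 1)).comp (X + 1) = (X + 1) * descPochhammer R n := by
    intro n
    rw [descPochhammer_succ_left, mul_comp, comp_assoc]
    simp
  have hL : ∀ n, F (assocLaguerre x y n) = descPochhammer R n ∧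
      F (assocLaguerre x y (n + 1)) = descPochhammer R (n + 1) := by
    intro n
    induction n with
    | zero =>
      have e1 : F 1 = 1 := by have := hF 0; rwa [pow_zero, h0] at this
      have eX : F X = X + C x + C y := by
        apply hreg
        have := hmul 1
        rw [mul_one, e1] at this
        rw [this]
        simp
        ring
      refine ⟨by simpa [assocLaguerre, recurrencePoly] using e1, ?_⟩
      have : assocLaguerre x y 1 = X - (x + y) • (1 : R[X]) := by
        simp [assocLaguerre, recurrencePoly, smul_eq_C_mul]
      rw [this, map_sub, map_smul, e1, eX, smul_eq_C_mul]
      simp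
    | succ n ih =>
      refine ⟨ih.2, ?_⟩
      -- The falling factorial of positive degree vanishes at 0, so the correction term drops out,
      -- and its shift by 1 supplies the factor `X + 1` to cancel.
      have e : F (X * assocLaguerre x y (n + 1))
          = (X + C y) * (X + 1 + C x) * descPochhammer R n := by
        apply hreg
        rw [hmul, ih.2, hdesc]
        simp
        ring
      have e2 : assocLaguerre x y (n + 2) = X * assocLaguerre x y (n + 1)
          - (2 * ((n + 1 : ℕ) : R) + x + y) • assocLaguerre x y (n + 1)
          - ((((n + 1 : ℕ) : R) + x) * (((n + 1 : ℕ) : R) + y - 1)) • assocLaguerre x y n := by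
        rw [smul_eq_C_mul, smul_eq_C_mul]
        simp only [assocLaguerre]
        rw [recurrencePoly]
        ring
      -- With w = z - n the claim is (w + n + y)(w + n + 1 + x) - (2n + 2 + x + y) w - (n + 1 + x)(n
      -- + y) = w(w - 1).
      rw [e2, map_sub, map_sub, map_smul, map_smul, e, ih.1, ih.2, descPochhammer_succ_right R (n + 1),
        descPochhammer_succ_right R n, smul_eq_C_mul, smul_eq_C_mul]
      simp [map_ofNat C 2]
      ring
  refine ⟨(leval 0).comp F, isMomentFunctional_recurrencePoly ?_ fun n => ?_, fun n => ?_⟩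
  · have := (hL 0).1
    simp only [assocLaguerre, recurrencePoly, descPochhammer_zero] at this
    simp [this]
  · have := (hL n).2
    simp only [assocLaguerre] at this
    simp [this, descPochhammer_succ_left]
  · simp [hF]

end Functional

/-! ### Weight polynomials and the effect of a new first column. -/

section WeightPolynomial

variable {R : Type*} [CommRing R]

open Polynomial in
/-- The polynomial that refines `X ^ (#U - 1) * Y ^ (∑ i ∈ U, a i)`, which is its value at `0`. -/
noncomputable def weightPoly (x y : R) (U : Finset ℕ) (a : ℕ → ℕ) : ℕ → R[X]
  | 0 => C (y ^ a 0)
  | n + 1 => if n + 1 ∈ U then weightPoly x y U a n * (X + C x)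
      + C ((y ^ a (n + 1) - 1) * x * (weightPoly x y U a n).eval 0) else weightPoly x y U a n

theorem weightPoly_congr (x y : R) {U V : Finset ℕ} {a b : ℕ → ℕ} {n : ℕ}
    (hU : ∀ i ≤ n, i ∈ U ↔ i ∈ V) (ha : ∀ i ≤ n, a i = b i) :
    weightPoly x y U a n = weightPoly x y V b n := by
  induction n with
  | zero => simp [weightPoly, ha]
  | succ n ih =>
    simp only [weightPoly]
    rw [ih (fun i hi => hU i (by omega)) (fun i hi => ha i (by omega)), ha (n + 1) le_rfl]
    simp only [hU (n + 1) le_rfl]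

/-- At 0 the added constant turns the factor `x` of a row into `x * y ^ a`. Row 0 contributes no
`x`, whence the exponent `urr - 1` later on. -/
theorem eval_weightPoly (x y : R) (U : Finset ℕ) (a : ℕ → ℕ) (n : ℕ) :
    (weightPoly x y U a n).eval 0
      = x ^ ((Finset.range n).filter fun i => i + 1 ∈ U).card
        * y ^ (a 0 + ∑ i ∈ (Finset.range n).filter (fun i => i + 1 ∈ U), a (i + 1)) := by
  induction n with
  | zero => simp [weightPoly]
  | succ n ih =>
    rw [weightPoly, Finset.range_add_one, Finset.filter_insert]
    split_ifs with h
    · rw [Finset.card_insert_of_notMem (by simp), Finset.sum_insert (by simp)]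
      simp only [Polynomial.eval_add, Polynomial.eval_mul, Polynomial.eval_X, Polynomial.eval_C, ih]
      ring
    · exact ih

/-- The unrestricted rows after a new first column with the set `S` of ones has been added. -/
def rowsAfter (U S : Finset ℕ) : Finset ℕ := U.filter fun i => i ∈ S ∨ ∀ s ∈ S, i ≤ s

theorem mem_rowsAfter {U S : Finset ℕ} {i : ℕ} :
    i ∈ rowsAfter U S ↔ i ∈ U ∧ (i ∈ S ∨ ∀ s ∈ S, i ≤ s) :=
  Finset.mem_filter

/-- The numbers of unrestricted columns with their topmost one in a given row, after a new first
column with the set `S` of ones has been added. -/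
def colsAfter (a : ℕ → ℕ) (S : Finset ℕ) (k : ℕ) : ℕ :=
  (if ∃ s ∈ S, s < k then 0 else a k) + if k ∈ S ∧ ∀ s ∈ S, k ≤ s then 1 else 0

/-- The sum of the weights over all ways to add a first column to a diagram with rows `0, …, n`. -/
noncomputable def addColSum (x y : R) (U : Finset ℕ) (a : ℕ → ℕ) (n : ℕ) : Polynomial R :=
  ∑ S ∈ (U.filter (· ≤ n)).powerset,
    if S = ∅ then 0 else weightPoly x y (rowsAfter U S) (colsAfter a S) n

-- Split by whether row n + 1 carries a new 1. For nonempty S above it, the row either becomes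
-- restricted (factor 1) or stays with no columns topped in it (factor z + x). The case S = {n + 1}
-- leaves the rows above untouched and raises the column count of row n + 1 by one.
open Polynomial in
theorem addColSum_succ (x y : R) (U : Finset ℕ) (a : ℕ → ℕ) (n : ℕ) (h : n + 1 ∈ U) :
    addColSum x y U a (n + 1) = addColSum x y U a n * (1 + X + C x)
      + weightPoly x y U a n * (X + C x)
      + C ((y ^ (a (n + 1) + 1) - 1) * x * (weightPoly x y U a n).eval 0) := by
  have hU : U.filter (· ≤ n + 1) = insert (n + 1) (U.filter (· ≤ n)) := by
    ext i
    simp only [Finset.mem_filter, Finset.mem_insert]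
    constructor
    · rintro ⟨h1, h2⟩
      by_cases h3 : i = n + 1
      · exact Or.inl h3
      · exact Or.inr ⟨h1, by omega⟩
    · rintro (rfl | ⟨h1, h2⟩)
      · exact ⟨h, le_rfl⟩
      · exact ⟨h1, by omega⟩
  have hle : ∀ S ∈ (U.filter (· ≤ n)).powerset, ∀ s ∈ S, s ≤ n := fun S hS s hs =>
    (Finset.mem_filter.1 (Finset.mem_powerset.1 hS hs)).2
  have h1 : ∀ S ∈ (U.filter (· ≤ n)).powerset,
      (if S = ∅ then 0 else weightPoly x y (rowsAfter U S) (colsAfter a S) (n + 1))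
      = if S = ∅ then 0 else weightPoly x y (rowsAfter U S) (colsAfter a S) n := by
    intro S hS
    split_ifs with h0
    · rfl
    · obtain ⟨s, hs⟩ := Finset.nonempty_iff_ne_empty.2 h0
      rw [weightPoly, if_neg]
      intro hm
      rcases (mem_rowsAfter.1 hm).2 with hm | hm
      · have := hle S hS _ hm
        omega
      · have := hm s hs
        have := hle S hS s hs
        omega
  have h2 : ∀ S ∈ (U.filter (· ≤ n)).powerset,
      (if insert (n + 1) S = ∅ then 0 else
        weightPoly x y (rowsAfter U (insert (n + 1) S)) (colsAfter a (insert (n + 1) S)) (n + 1))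
      = (if S = ∅ then 0 else weightPoly x y (rowsAfter U S) (colsAfter a S) n) * (X + C x)
        + if ∅ = S then weightPoly x y U a n * (X + C x)
      + C ((y ^ (a (n + 1) + 1) - 1) * x * (weightPoly x y U a n).eval 0) else 0 := by
    intro S hS
    have hle' := hle S hS
    rw [if_neg (Finset.insert_ne_empty _ _), weightPoly,
      if_pos (mem_rowsAfter.2 ⟨h, Or.inl (Finset.mem_insert_self _ _)⟩)]
    by_cases h0 : S = ∅
    · subst h0
      have e : weightPoly x y (rowsAfter U {n + 1}) (colsAfter a {n + 1}) n
          = weightPoly x y U a n := by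
        apply weightPoly_congr
        · intro i hi
          simp only [rowsAfter, Finset.mem_filter, Finset.mem_singleton, forall_eq]
          constructor
          · exact fun h => h.1
          · exact fun h => ⟨h, Or.inr (by omega)⟩
        · intro i hi
          have h3 : ¬ n + 1 < i := by omega
          have h4 : i ≠ n + 1 := by omega
          simp [colsAfter, h3, h4]
      simp [e, colsAfter]
    · obtain ⟨s, hs⟩ := Finset.nonempty_iff_ne_empty.2 h0
      have hsn := hle' s hs
      have e : weightPoly x y (rowsAfter U (insert (n + 1) S)) (colsAfter a (insert (n + 1) S)) n
          = weightPoly x y (rowsAfter U S) (colsAfter a S) n := by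
        apply weightPoly_congr
        · intro i hi
          have h3 : i ≤ n + 1 := by omega
          have h4 : i ≠ n + 1 := by omega
          simp [rowsAfter, h3, h4]
        · intro i hi
          have h3 : ¬ n + 1 < i := by omega
          have h3' : i ≤ n + 1 := by omega
          have h4 : i ≠ n + 1 := by omega
          simp [colsAfter, h3, h3', h4]
      -- A 1 of S above row n + 1 spoils all columns topped in that row, and the topmost new 1 is
      -- not there either.
      have e0 : colsAfter a (insert (n + 1) S) (n + 1) = 0 := by
        have h3 : ∃ t ∈ insert (n + 1) S, t < n + 1 := ⟨s, Finset.mem_insert_of_mem hs, by omega⟩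
        have h4 : ¬ (n + 1 ∈ insert (n + 1) S ∧ ∀ t ∈ insert (n + 1) S, n + 1 ≤ t) := by
          rintro ⟨-, h4⟩
          have := h4 s (Finset.mem_insert_of_mem hs)
          omega
        rw [colsAfter, if_pos h3, if_neg h4]
      rw [e, e0, if_neg h0, if_neg (Ne.symm h0)]
      simp
  rw [addColSum, hU, Finset.sum_powerset_insert (by simp), Finset.sum_congr rfl h1,
    Finset.sum_congr rfl h2, Finset.sum_add_distrib, ← Finset.sum_mul, Finset.sum_ite_eq,
    if_pos (Finset.empty_mem_powerset _), ← addColSum]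
  ring

theorem addColSum_succ_of_notMem (x y : R) (U : Finset ℕ) (a : ℕ → ℕ) (n : ℕ) (h : n + 1 ∉ U) :
    addColSum x y U a (n + 1) = addColSum x y U a n := by
  have hU : U.filter (· ≤ n + 1) = U.filter (· ≤ n) := by
    apply Finset.filter_congr
    intro i hi
    have : i ≠ n + 1 := fun h' => h (h' ▸ hi)
    omega
  rw [addColSum, addColSum, hU]
  refine Finset.sum_congr rfl fun S _ => ?_
  rw [weightPoly, if_neg fun hm => h (mem_rowsAfter.1 hm).1]

open Polynomial in
theorem X_add_one_mul_addColSum (x y : R) (U : Finset ℕ) (a : ℕ → ℕ) (h0 : 0 ∈ U) (n : ℕ) :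
    (X + 1) * (weightPoly x y U a n * (X + C x) + addColSum x y U a n)
      = (X + C y) * (X + 1 + C x) * (weightPoly x y U a n).comp (X + 1)
        - C ((y - 1) * x * (weightPoly x y U a n).eval 0) := by
  induction n with
  | zero =>
    have hU : U.filter (· ≤ 0) = {0} := by
      ext i
      simp only [nonpos_iff_eq_zero, Finset.mem_filter, Finset.mem_singleton]
      exact ⟨fun h => h.2, fun h => ⟨h ▸ h0, h⟩⟩
    have e : addColSum x y U a 0 = C (y ^ (a 0 + 1)) := by
      rw [addColSum, hU, ← insert_empty_eq, Finset.sum_powerset_insert (by simp)]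
      simp [weightPoly, colsAfter]
    rw [e]
    simp only [weightPoly, C_comp, eval_C]
    simp only [map_mul, map_sub, map_one, map_pow]
    ring
  | succ n ih =>
    by_cases h : n + 1 ∈ U
    · rw [addColSum_succ x y U a n h, weightPoly, if_pos h]
      simp only [add_comp, mul_comp, C_comp, X_comp, eval_add, eval_mul, eval_X, eval_C,
        zero_add] at ih ⊢
      simp only [map_mul, map_sub, map_one, map_pow, map_add] at ih ⊢
      -- The factor z + 1 + x appears on the left as (z + x) + 1 and on the right as the shift of z
      -- + x. What remains is an identity between multiples of x W(0), where W is the weight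
      -- polynomial up to row n.
      linear_combination (X + 1 + C x) * ih
    · rw [addColSum_succ_of_notMem x y U a n h, weightPoly, if_neg h]
      exact ih

end WeightPolynomial

theorem Finset.card_eq_card_add_of_succ_mem_iff {A B : Finset ℕ} (h : ∀ j, j + 1 ∈ A ↔ j ∈ B) :
    A.card = B.card + if 0 ∈ A then 1 else 0 := by
  have e : A.erase 0 = B.map ⟨Nat.succ, Nat.succ_injective⟩ := by
    ext j
    rcases j with _ | j <;> simp [h]
  have := congrArg Finset.card e
  rw [Finset.card_map] at this
  split_ifs with h0
  · rw [← this, Finset.card_erase_add_one h0]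
  · rw [← this, Finset.erase_eq_of_notMem h0, add_zero]

/-! ### Unrestricted rows and columns, and topmost ones. -/

namespace PermutationTableau

theorem lt_numCols_iff (T : PermutationTableau) {j : ℕ} : j < T.numCols ↔ (0, j) ∈ T.shape :=
  YoungDiagram.mem_iff_lt_rowLen.symm

theorem lt_numCols (T : PermutationTableau) {i j : ℕ} (h : (i, j) ∈ T.shape) : j < T.numCols :=
  T.lt_numCols_iff.2 (T.shape.up_left_mem (Nat.zero_le _) le_rfl h)

theorem lt_numRows (T : PermutationTableau) {i j : ℕ} (h : (i, j) ∈ T.shape) : i < T.numRows :=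
  (YoungDiagram.mem_iff_lt_colLen.1 (T.shape.up_left_mem le_rfl (Nat.zero_le _) h)).trans_le
    T.colLen_le

theorem mem_shape_of_mem_ones (T : PermutationTableau) {c : ℕ × ℕ} (h : c ∈ T.ones) :
    c ∈ T.shape :=
  T.ones_subset h

open Classical in
/-- The set of unrestricted rows. -/
noncomputable def unrestrictedRows (T : PermutationTableau) : Finset ℕ :=
  (Finset.range T.numRows).filter fun i => ¬ ∃ j, T.IsRestrictedZero i j

open Classical in
/-- The set of unrestricted columns. -/
noncomputable def unrestrictedCols (T : PermutationTableau) : Finset ℕ :=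
  (Finset.range T.numCols).filter fun j => ¬ ∃ i, T.IsCRestrictedZero i j

theorem mem_unrestrictedRows {T : PermutationTableau} {i : ℕ} :
    i ∈ T.unrestrictedRows ↔ i < T.numRows ∧ ¬ ∃ j, T.IsRestrictedZero i j := by
  simp [unrestrictedRows]

theorem mem_unrestrictedCols {T : PermutationTableau} {j : ℕ} :
    j ∈ T.unrestrictedCols ↔ j < T.numCols ∧ ¬ ∃ i, T.IsCRestrictedZero i j := by
  simp [unrestrictedCols]

/-- The topmost 1 of column `j` is in row `k`. -/
def IsTop (T : PermutationTableau) (k j : ℕ) : Prop :=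
  (k, j) ∈ T.ones ∧ ∀ i < k, (i, j) ∉ T.ones

open Classical in
/-- The unrestricted columns whose topmost 1 is in row `k`. -/
noncomputable def topCols (T : PermutationTableau) (k : ℕ) : Finset ℕ :=
  T.unrestrictedCols.filter fun j => T.IsTop k j

theorem mem_topCols {T : PermutationTableau} {k j : ℕ} :
    j ∈ T.topCols k ↔ (j < T.numCols ∧ ¬ ∃ i, T.IsCRestrictedZero i j) ∧ T.IsTop k j := by
  simp [topCols, mem_unrestrictedCols]

/-- The number of unrestricted columns whose topmost 1 is in row `k`. -/
noncomputable def topCount (T : PermutationTableau) (k : ℕ) : ℕ := (T.topCols k).card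

theorem exists_isTop (T : PermutationTableau) {j : ℕ} (hj : j < T.numCols) : ∃ k, T.IsTop k j := by
  classical
  have h := T.exists_one j hj
  exact ⟨Nat.find h, Nat.find_spec h, fun i hi => Nat.find_min h hi⟩

theorem IsTop.unique {T : PermutationTableau} {k k' j : ℕ} (h : T.IsTop k j) (h' : T.IsTop k' j) :
    k = k' := by
  rcases lt_trichotomy k k' with hk | hk | hk
  · exact absurd h.1 (h'.2 k hk)
  · exact hk
  · exact absurd h'.1 (h.2 k' hk)

/-- A restricted 0 of row k to the right of column j would have a 1 above and a 1 to its left. One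
to the left of column j has a 1 above it, and that 1 makes the 0 of column j in its row
c-restricted. -/
theorem mem_unrestrictedRows_of_isTop {T : PermutationTableau} {k j : ℕ}
    (hj : j ∈ T.unrestrictedCols) (hk : T.IsTop k j) : k ∈ T.unrestrictedRows := by
  have hkj := T.mem_shape_of_mem_ones hk.1
  refine mem_unrestrictedRows.2 ⟨T.lt_numRows hkj, ?_⟩
  rintro ⟨j', hs, h0, i', hi', h1⟩
  rcases lt_trichotomy j j' with h | rfl | h
  · exact T.not_above_and_left k j' hs h0 ⟨⟨i', hi', h1⟩, j, h, hk.1⟩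
  · exact h0 hk.1
  · exact (mem_unrestrictedCols.1 hj).2
      ⟨i', T.shape.up_left_mem hi'.le le_rfl hkj, hk.2 i' hi', j', h, h1⟩

theorem urc_eq_sum_topCount (T : PermutationTableau) :
    T.urc = ∑ k ∈ T.unrestrictedRows, T.topCount k := by
  classical
  have : T.unrestrictedCols = T.unrestrictedRows.biUnion T.topCols := by
    ext j
    simp only [Finset.mem_biUnion]
    constructor
    · intro hj
      obtain ⟨k, hk⟩ := T.exists_isTop (mem_unrestrictedCols.1 hj).1
      exact ⟨k, mem_unrestrictedRows_of_isTop hj hk, mem_topCols.2 ⟨mem_unrestrictedCols.1 hj, hk⟩⟩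
    · rintro ⟨k, -, hk⟩
      exact mem_unrestrictedCols.2 (mem_topCols.1 hk).1
  change T.unrestrictedCols.card = _
  rw [this, Finset.card_biUnion]
  · rfl
  · intro k _ k' _ hkk'
    refine Finset.disjoint_left.2 fun j hj hj' => ?_
    exact hkk' ((mem_topCols.1 hj).2.unique (mem_topCols.1 hj').2)

theorem zero_mem_unrestrictedRows {T : PermutationTableau} (h : 0 < T.numRows) :
    0 ∈ T.unrestrictedRows := by
  refine mem_unrestrictedRows.2 ⟨h, ?_⟩
  rintro ⟨j, -, -, i', hi', -⟩
  omega

/-! ### The weight of a tableau. -/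

section Weight

variable {R : Type*} [CommRing R]

/-- The polynomial weight of a permutation tableau. -/
noncomputable def weight (x y : R) (T : PermutationTableau) : Polynomial R :=
  weightPoly x y T.unrestrictedRows T.topCount (T.numRows - 1)

theorem eval_weight (x y : R) {T : PermutationTableau} (h : 0 < T.numRows) :
    (T.weight x y).eval 0 = x ^ (T.urr - 1) * y ^ T.urc := by
  have hmem : ∀ j, j + 1 ∈ T.unrestrictedRows ↔
      j ∈ (Finset.range (T.numRows - 1)).filter fun i => i + 1 ∈ T.unrestrictedRows := by
    intro j
    simp only [Finset.mem_filter, Finset.mem_range]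
    refine ⟨fun hj => ⟨?_, hj⟩, fun hj => hj.2⟩
    have := (mem_unrestrictedRows.1 hj).1
    omega
  have hcard := Finset.card_eq_card_add_of_succ_mem_iff hmem
  have h0 := zero_mem_unrestrictedRows h
  rw [if_pos h0] at hcard
  have hsum : T.unrestrictedRows = insert 0
      (((Finset.range (T.numRows - 1)).filter fun i => i + 1 ∈ T.unrestrictedRows).map
        ⟨Nat.succ, Nat.succ_injective⟩) := by
    ext i
    rcases i with _ | i
    · simp [h0]
    · rw [hmem]
      simp
  have hurr : T.urr = T.unrestrictedRows.card := rfl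
  rw [weight, eval_weightPoly, hurr, hcard, Nat.add_sub_cancel, urc_eq_sum_topCount]
  have hsum' := congrArg (fun s => ∑ k ∈ s, T.topCount k) hsum
  rw [Finset.sum_insert (by simp), Finset.sum_map] at hsum'
  rw [hsum']
  rfl

end Weight

/-! ### Empty last rows. -/

/-- Remove an empty last row. -/
def delRow (T : PermutationTableau) (h : T.shape.colLen 0 < T.numRows) : PermutationTableau where
  shape := T.shape
  numRows := T.numRows - 1
  colLen_le := by omega
  ones := T.ones
  ones_subset := T.ones_subset
  exists_one := T.exists_one
  not_above_and_left := T.not_above_and_left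

/-- Add an empty last row. -/
def addRow (T : PermutationTableau) : PermutationTableau where
  shape := T.shape
  numRows := T.numRows + 1
  colLen_le := T.colLen_le.trans (Nat.le_succ _)
  ones := T.ones
  ones_subset := T.ones_subset
  exists_one := T.exists_one
  not_above_and_left := T.not_above_and_left

/-- An empty row is unrestricted and tops no column. The bound `2 ≤ T.numRows` keeps it apart from
row 0, which contributes no factor z + x. -/
theorem weight_eq_of_colLen_lt {R : Type*} [CommRing R] (x y : R) {T : PermutationTableau}
    (h : T.shape.colLen 0 < T.numRows) (h2 : 2 ≤ T.numRows) :
    T.weight x y = (T.delRow h).weight x y * (Polynomial.X + Polynomial.C x) := by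
  obtain ⟨n, hn⟩ : ∃ n, T.numRows = n + 2 := ⟨T.numRows - 2, by omega⟩
  have hnot : ∀ j, (n + 1, j) ∉ T.shape := by
    intro j hj
    have := YoungDiagram.mem_iff_lt_colLen.1 (T.shape.up_left_mem le_rfl (Nat.zero_le j) hj)
    omega
  have e1 : T.numRows - 1 = n + 1 := by omega
  have e2 : (T.delRow h).numRows - 1 = n := by
    change T.numRows - 1 - 1 = n
    omega
  have hmem : n + 1 ∈ T.unrestrictedRows :=
    mem_unrestrictedRows.2 ⟨by omega, fun ⟨j, hj, _⟩ => hnot j hj⟩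
  have htop : T.topCount (n + 1) = 0 := by
    refine Finset.card_eq_zero.2 (Finset.eq_empty_of_forall_notMem fun j hj => ?_)
    exact hnot j (T.mem_shape_of_mem_ones (mem_topCols.1 hj).2.1)
  have hc : weightPoly x y T.unrestrictedRows T.topCount n
      = weightPoly x y (T.delRow h).unrestrictedRows (T.delRow h).topCount n := by
    refine weightPoly_congr x y (fun i hi => ?_) (fun i _ => rfl)
    rw [mem_unrestrictedRows, mem_unrestrictedRows]
    have h1 : i < T.numRows := by omega
    have h2 : i < (T.delRow h).numRows := by
      change i < T.numRows - 1
      omega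
    simp only [h1, h2]
    rfl
  rw [weight, weight, e1, e2, weightPoly, if_pos hmem, htop, hc]
  simp

/-! ### Removing and adding a first column. -/

/-- Remove the cells with second coordinate `0` and shift the others to the left. -/
def tailCells (s : Finset (ℕ × ℕ)) : Finset (ℕ × ℕ) :=
  (s.filter fun c => 0 < c.2).image fun c => (c.1, c.2 - 1)

theorem mem_tailCells {s : Finset (ℕ × ℕ)} {i j : ℕ} : (i, j) ∈ tailCells s ↔ (i, j + 1) ∈ s := by
  simp only [tailCells, Finset.mem_image, Finset.mem_filter, Prod.exists, Prod.mk.injEq]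
  constructor
  · rintro ⟨a, b, ⟨h, hb⟩, rfl, rfl⟩
    rwa [Nat.sub_add_cancel hb]
  · exact fun h => ⟨i, j + 1, ⟨h, by omega⟩, rfl, rfl⟩

/-- Shift the cells to the right and add cells with second coordinate `0` in the rows in `S`. -/
def consCells (S : Finset ℕ) (s : Finset (ℕ × ℕ)) : Finset (ℕ × ℕ) :=
  s.image (fun c => (c.1, c.2 + 1)) ∪ S ×ˢ {0}

theorem mem_consCells_zero {S : Finset ℕ} {s : Finset (ℕ × ℕ)} {i : ℕ} :
    (i, 0) ∈ consCells S s ↔ i ∈ S := by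
  simp [consCells]

theorem mem_consCells_succ {S : Finset ℕ} {s : Finset (ℕ × ℕ)} {i j : ℕ} :
    (i, j + 1) ∈ consCells S s ↔ (i, j) ∈ s := by
  simp [consCells]

/-- The Young diagram without its first column. -/
def tailDiagram (μ : YoungDiagram) : YoungDiagram where
  cells := tailCells μ.cells
  isLowerSet := by
    rintro ⟨i, j⟩ ⟨i', j'⟩ hle hc
    exact mem_tailCells.2 (μ.up_left_mem hle.1 (Nat.succ_le_succ hle.2) (mem_tailCells.1 hc))

theorem mem_tailDiagram {μ : YoungDiagram} {i j : ℕ} :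
    (i, j) ∈ tailDiagram μ ↔ (i, j + 1) ∈ μ :=
  mem_tailCells

/-- The Young diagram with an additional first column of length `n`. -/
def consDiagram (μ : YoungDiagram) (n : ℕ) (h : ∀ i j, (i, j) ∈ μ → i < n) : YoungDiagram where
  cells := consCells (Finset.range n) μ.cells
  isLowerSet := by
    rintro ⟨i, j⟩ ⟨i', j'⟩ ⟨hle1, hle2⟩ hc
    have hi : i < n := by
      rcases j with _ | j
      · exact Finset.mem_range.1 (mem_consCells_zero.1 hc)
      · exact h i j (mem_consCells_succ.1 hc)
    rcases j' with _ | j'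
    · exact mem_consCells_zero.2 (Finset.mem_range.2 (lt_of_le_of_lt hle1 hi))
    · rcases j with _ | j
      · exact absurd hle2 (Nat.not_succ_le_zero _)
      · exact mem_consCells_succ.2
          (μ.up_left_mem hle1 (Nat.le_of_succ_le_succ hle2) (mem_consCells_succ.1 hc))

theorem mem_consDiagram_zero {μ : YoungDiagram} {n : ℕ} {h : ∀ i j, (i, j) ∈ μ → i < n} {i : ℕ} :
    (i, 0) ∈ consDiagram μ n h ↔ i < n :=
  mem_consCells_zero.trans Finset.mem_range

theorem mem_consDiagram_succ {μ : YoungDiagram} {n : ℕ} {h : ∀ i j, (i, j) ∈ μ → i < n}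
    {i j : ℕ} : (i, j + 1) ∈ consDiagram μ n h ↔ (i, j) ∈ μ :=
  mem_consCells_succ

/-- Remove the first column. -/
def delCol (T : PermutationTableau) : PermutationTableau where
  shape := tailDiagram T.shape
  numRows := T.numRows
  colLen_le := by
    by_contra! h
    exact absurd (T.lt_numRows (mem_tailDiagram.1 (YoungDiagram.mem_iff_lt_colLen.2 h)))
      (lt_irrefl _)
  ones := tailCells T.ones
  ones_subset := by
    rintro ⟨i, j⟩ hc
    exact mem_tailCells.2 (T.ones_subset (mem_tailCells.1 hc))
  exists_one := by
    intro j hj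
    obtain ⟨i, hi⟩ := T.exists_one (j + 1)
      (T.lt_numCols (mem_tailDiagram.1 (YoungDiagram.mem_iff_lt_rowLen.2 hj)))
    exact ⟨i, mem_tailCells.2 hi⟩
  not_above_and_left := by
    rintro i j hs h0 ⟨⟨i', hi', h1⟩, j', hj', h2⟩
    exact T.not_above_and_left i (j + 1) (mem_tailDiagram.1 hs)
      (fun h => h0 (mem_tailCells.2 h))
      ⟨⟨i', hi', mem_tailCells.1 h1⟩, j' + 1, by omega, mem_tailCells.1 h2⟩

theorem mem_delCol_shape {T : PermutationTableau} {i j : ℕ} :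
    (i, j) ∈ T.delCol.shape ↔ (i, j + 1) ∈ T.shape :=
  mem_tailDiagram

theorem mem_delCol_ones {T : PermutationTableau} {i j : ℕ} :
    (i, j) ∈ T.delCol.ones ↔ (i, j + 1) ∈ T.ones :=
  mem_tailCells

/-- The rows of the ones in the first column. -/
def firstCol (T : PermutationTableau) : Finset ℕ :=
  (Finset.range T.numRows).filter fun i => (i, 0) ∈ T.ones

theorem mem_firstCol {T : PermutationTableau} {i : ℕ} : i ∈ T.firstCol ↔ (i, 0) ∈ T.ones := by
  simp only [firstCol, Finset.mem_filter, Finset.mem_range, and_iff_right_iff_imp]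
  exact fun h => T.lt_numRows (T.mem_shape_of_mem_ones h)

theorem isRestrictedZero_delCol {T : PermutationTableau} {i j : ℕ} :
    T.delCol.IsRestrictedZero i j ↔ T.IsRestrictedZero i (j + 1) := by
  simp only [IsRestrictedZero, mem_delCol_shape, mem_delCol_ones]

theorem firstCol_subset (T : PermutationTableau) : T.firstCol ⊆ T.delCol.unrestrictedRows := by
  intro i hi
  have hi' := mem_firstCol.1 hi
  refine mem_unrestrictedRows.2 ⟨T.lt_numRows (T.mem_shape_of_mem_ones hi'), ?_⟩
  rintro ⟨j, hj⟩
  obtain ⟨hs, h0, h1⟩ := isRestrictedZero_delCol.1 hj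
  exact T.not_above_and_left i (j + 1) hs h0 ⟨h1, 0, by omega, hi'⟩

/-- Since the first column meets every row, a row becomes restricted exactly when it has a 0 there
below some 1. -/
theorem unrestrictedRows_eq_rowsAfter {T : PermutationTableau}
    (hT : T.shape.colLen 0 = T.numRows) :
    T.unrestrictedRows = rowsAfter T.delCol.unrestrictedRows T.firstCol := by
  ext i
  rw [rowsAfter, Finset.mem_filter, mem_unrestrictedRows, mem_unrestrictedRows]
  constructor
  · rintro ⟨hi, h⟩
    refine ⟨⟨hi, fun ⟨j, hj⟩ => h ⟨j + 1, isRestrictedZero_delCol.1 hj⟩⟩, ?_⟩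
    by_contra! hcon
    obtain ⟨hS, s, hs, hsi⟩ := hcon
    rw [mem_firstCol] at hS hs
    exact h ⟨0, YoungDiagram.mem_iff_lt_colLen.2 (by omega), hS, s, hsi, hs⟩
  · rintro ⟨⟨hi, h⟩, hS⟩
    refine ⟨hi, ?_⟩
    rintro ⟨_ | j, hj⟩
    · obtain ⟨-, h0, s, hs, h1⟩ := hj
      rw [← mem_firstCol] at h0 h1
      rcases hS with hS | hS
      · exact h0 hS
      · have := hS s h1
        omega
    · exact h ⟨j, isRestrictedZero_delCol.2 hj⟩

/-- An old column topped in row k is spoilt exactly by a first-column 1 above row k. The first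
column itself is always unrestricted and is topped at its smallest row. -/
theorem topCount_eq_colsAfter (T : PermutationTableau) (k : ℕ) :
    T.topCount k = colsAfter T.delCol.topCount T.firstCol k := by
  have h0 : 0 ∈ T.topCols k ↔ k ∈ T.firstCol ∧ ∀ s ∈ T.firstCol, k ≤ s := by
    rw [mem_topCols, mem_firstCol]
    constructor
    · rintro ⟨-, h1, h2⟩
      refine ⟨h1, fun s hs => ?_⟩
      by_contra! hlt
      exact h2 s hlt (mem_firstCol.1 hs)
    · rintro ⟨h1, h2⟩
      refine ⟨⟨T.lt_numCols (T.mem_shape_of_mem_ones h1), ?_⟩, h1, fun i hi hi' => ?_⟩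
      · rintro ⟨i, -, -, j', hj', -⟩
        omega
      · have := h2 i (mem_firstCol.2 hi')
        omega
  have hsucc : ∀ j, j + 1 ∈ T.topCols k ↔
      j ∈ if ∃ s ∈ T.firstCol, s < k then ∅ else T.delCol.topCols k := by
    intro j
    rw [mem_topCols]
    constructor
    · rintro ⟨⟨-, h1⟩, h2⟩
      have hs2 := T.mem_shape_of_mem_ones h2.1
      rw [if_neg]
      · refine mem_topCols.2 ⟨⟨T.delCol.lt_numCols (mem_delCol_shape.2 hs2), ?_⟩,
          mem_delCol_ones.2 h2.1, fun i hi hi' => h2.2 i hi (mem_delCol_ones.1 hi')⟩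
        rintro ⟨i, hs, hz, j', hj', ho⟩
        exact h1 ⟨i, mem_delCol_shape.1 hs, fun hz' => hz (mem_delCol_ones.2 hz'), j' + 1,
          by omega, mem_delCol_ones.1 ho⟩
      · rintro ⟨s, hs, hsk⟩
        exact h1 ⟨s, T.shape.up_left_mem hsk.le le_rfl hs2, h2.2 s hsk, 0, by omega,
          mem_firstCol.1 hs⟩
    · intro h
      split_ifs at h with hc
      · simp at h
      · obtain ⟨⟨-, h1⟩, h2⟩ := mem_topCols.1 h
        have hk := mem_delCol_ones.1 h2.1
        refine ⟨⟨T.lt_numCols (T.mem_shape_of_mem_ones hk), ?_⟩, hk,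
          fun i hi hi' => h2.2 i hi (mem_delCol_ones.2 hi')⟩
        rintro ⟨i, hs, hz, _ | j', hj', ho⟩
        -- A 0 below the topmost 1 cannot have a first-column 1 in its row, by the tableau
        -- condition.
        · rcases lt_trichotomy i k with hik | rfl | hik
          · exact hc ⟨i, mem_firstCol.2 ho, hik⟩
          · exact hz hk
          · exact T.not_above_and_left i (j + 1) hs hz ⟨⟨k, hik, hk⟩, 0, by omega, ho⟩
        · exact h1 ⟨i, mem_delCol_shape.2 hs, fun hz' => hz (mem_delCol_ones.1 hz'), j',
            by omega, mem_delCol_ones.2 ho⟩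
  rw [topCount, Finset.card_eq_card_add_of_succ_mem_iff hsucc, colsAfter]
  simp only [h0]
  congr 1
  split_ifs <;> rfl

theorem weight_eq_of_colLen_eq {R : Type*} [CommRing R] (x y : R) {T : PermutationTableau}
    (hT : T.shape.colLen 0 = T.numRows) :
    T.weight x y = weightPoly x y (rowsAfter T.delCol.unrestrictedRows T.firstCol)
      (colsAfter T.delCol.topCount T.firstCol) (T.delCol.numRows - 1) := by
  rw [weight, unrestrictedRows_eq_rowsAfter hT, funext T.topCount_eq_colsAfter]
  rfl

/-- Add a first column as long as possible with the nonempty set `S` of ones. -/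
def addCol (T : PermutationTableau) (S : Finset ℕ) (hS : S ⊆ T.unrestrictedRows)
    (hne : S.Nonempty) : PermutationTableau where
  shape := consDiagram T.shape T.numRows fun _ _ h => T.lt_numRows h
  numRows := T.numRows
  colLen_le := by
    by_contra! h
    exact absurd (mem_consDiagram_zero.1 (YoungDiagram.mem_iff_lt_colLen.2 h)) (lt_irrefl _)
  ones := consCells S T.ones
  ones_subset := by
    rintro ⟨i, _ | j⟩ hc
    · exact mem_consCells_zero.2 (Finset.mem_range.2
        (mem_unrestrictedRows.1 (hS (mem_consCells_zero.1 hc))).1)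
    · exact mem_consCells_succ.2 (T.ones_subset (mem_consCells_succ.1 hc))
  exists_one := by
    rintro (_ | j) hj
    · obtain ⟨s, hs⟩ := hne
      exact ⟨s, mem_consCells_zero.2 hs⟩
    · obtain ⟨i, hi⟩ := T.exists_one j
        (T.lt_numCols (mem_consDiagram_succ.1 (YoungDiagram.mem_iff_lt_rowLen.2 hj)))
      exact ⟨i, mem_consCells_succ.2 hi⟩
  not_above_and_left := by
    rintro i (_ | j) hs h0 ⟨⟨i', hi', h1⟩, j', hj', h2⟩
    · omega
    · rw [mem_consDiagram_succ] at hs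
      rw [mem_consCells_succ] at h0 h1
      rcases j' with _ | j'
      · exact (mem_unrestrictedRows.1 (hS (mem_consCells_zero.1 h2))).2 ⟨j, hs, h0, i', hi', h1⟩
      · exact T.not_above_and_left i j hs h0
          ⟨⟨i', hi', h1⟩, j', by omega, mem_consCells_succ.1 h2⟩

section AddCol

variable {T : PermutationTableau} {S : Finset ℕ} {hS : S ⊆ T.unrestrictedRows} {hne : S.Nonempty}

theorem mem_addCol_shape_succ {i j : ℕ} :
    (i, j + 1) ∈ (T.addCol S hS hne).shape ↔ (i, j) ∈ T.shape :=
  mem_consDiagram_succ (h := fun _ _ h => T.lt_numRows h)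

theorem mem_addCol_shape_zero {i : ℕ} :
    (i, 0) ∈ (T.addCol S hS hne).shape ↔ i < T.numRows :=
  mem_consDiagram_zero (h := fun _ _ h => T.lt_numRows h)

theorem mem_addCol_ones_succ {i j : ℕ} :
    (i, j + 1) ∈ (T.addCol S hS hne).ones ↔ (i, j) ∈ T.ones :=
  mem_consCells_succ

theorem mem_addCol_ones_zero {i : ℕ} : (i, 0) ∈ (T.addCol S hS hne).ones ↔ i ∈ S :=
  mem_consCells_zero

theorem colLen_addCol : (T.addCol S hS hne).shape.colLen 0 = (T.addCol S hS hne).numRows := by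
  refine eq_of_forall_lt_iff fun i => ?_
  rw [← YoungDiagram.mem_iff_lt_colLen, mem_addCol_shape_zero]
  rfl

theorem delCol_addCol : (T.addCol S hS hne).delCol = T := by
  apply PermutationTableau.ext
  · refine YoungDiagram.ext (Finset.ext fun ⟨i, j⟩ => ?_)
    rw [YoungDiagram.mem_cells, YoungDiagram.mem_cells, mem_delCol_shape, mem_addCol_shape_succ]
  · rfl
  · ext ⟨i, j⟩
    rw [mem_delCol_ones, mem_addCol_ones_succ]

theorem firstCol_addCol : (T.addCol S hS hne).firstCol = S := by
  ext i
  rw [mem_firstCol, mem_addCol_ones_zero]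

end AddCol

theorem addCol_delCol {T : PermutationTableau} (hT : T.shape.colLen 0 = T.numRows)
    (hne : T.firstCol.Nonempty) : T.delCol.addCol T.firstCol T.firstCol_subset hne = T := by
  apply PermutationTableau.ext
  · refine YoungDiagram.ext (Finset.ext ?_)
    rintro ⟨i, _ | j⟩
    · rw [YoungDiagram.mem_cells, YoungDiagram.mem_cells, mem_addCol_shape_zero,
        YoungDiagram.mem_iff_lt_colLen, hT]
      rfl
    · rw [YoungDiagram.mem_cells, YoungDiagram.mem_cells, mem_addCol_shape_succ, mem_delCol_shape]
  · rfl
  · ext ⟨i, _ | j⟩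
    · rw [mem_addCol_ones_zero, mem_firstCol]
    · rw [mem_addCol_ones_succ, mem_delCol_ones]

theorem numCols_delCol (T : PermutationTableau) : T.delCol.numCols = T.numCols - 1 := by
  refine eq_of_forall_lt_iff fun j => ?_
  rw [lt_numCols_iff, mem_delCol_shape, ← lt_numCols_iff]
  omega

theorem numRows_pos {T : PermutationTableau} (h : 0 < T.length) : 0 < T.numRows := by
  rcases Nat.eq_zero_or_pos T.numCols with h0 | h0
  · rw [length, h0] at h
    exact h
  · exact T.lt_numRows (T.lt_numCols_iff.1 h0)

theorem numCols_pos {T : PermutationTableau} (h : 0 < T.length)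
    (hT : T.shape.colLen 0 = T.numRows) : 0 < T.numCols := by
  have h1 := numRows_pos h
  rw [← hT] at h1
  exact T.lt_numCols (YoungDiagram.mem_iff_lt_colLen.2 h1)

/-! ### The recursion on the length. -/

section Sum

variable {R : Type*} [CommRing R] (x y : R) (n : ℕ)

theorem sum_weight_colLen_lt :
    ∑ T ∈ (PT (n + 2)).filter (fun T => T.shape.colLen 0 < T.numRows), T.weight x y
      = ∑ T ∈ PT (n + 1), T.weight x y * (Polynomial.X + Polynomial.C x) := by
  refine Finset.sum_bij' (fun T hT => T.delRow (Finset.mem_filter.1 hT).2) (fun T _ => T.addRow)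
    ?_ ?_ ?_ ?_ ?_
  · intro T hT
    have h1 := mem_PT.1 (Finset.mem_filter.1 hT).1
    have h2 := (Finset.mem_filter.1 hT).2
    refine mem_PT.2 ?_
    change T.numRows + T.numCols = n + 2 at h1
    change T.numRows - 1 + T.numCols = n + 1
    omega
  · intro T hT
    have h1 : T.numRows + T.numCols = n + 1 := mem_PT.1 hT
    refine Finset.mem_filter.2 ⟨mem_PT.2 ?_, Nat.lt_succ_of_le T.colLen_le⟩
    change T.numRows + 1 + T.numCols = n + 2
    omega
  · intro T hT
    have h2 := (Finset.mem_filter.1 hT).2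
    apply PermutationTableau.ext
    · rfl
    · change T.numRows - 1 + 1 = T.numRows
      omega
    · rfl
  · intro T hT
    rfl
  · intro T hT
    have h1 : T.numRows + T.numCols = n + 2 := mem_PT.1 (Finset.mem_filter.1 hT).1
    have h2 := (Finset.mem_filter.1 hT).2
    refine weight_eq_of_colLen_lt x y h2 ?_
    -- A single row would leave at least one column, so that row would not be empty.
    by_contra! h3
    have h4 : (0, 0) ∈ T.shape := T.lt_numCols_iff.1 (by omega)
    have := YoungDiagram.mem_iff_lt_colLen.1 h4
    omega

/-- Such a tableau is the same as the pair of `delCol` and `firstCol`, the latter ranging over all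
nonempty sets of unrestricted rows of the former. -/
theorem sum_weight_colLen_eq :
    ∑ T ∈ (PT (n + 2)).filter (fun T => ¬ T.shape.colLen 0 < T.numRows), T.weight x y
      = ∑ T ∈ PT (n + 1), addColSum x y T.unrestrictedRows T.topCount (T.numRows - 1) := by
  have e : ∀ T ∈ PT (n + 1), addColSum x y T.unrestrictedRows T.topCount (T.numRows - 1)
      = ∑ S ∈ T.unrestrictedRows.powerset.filter (fun S => ¬ S = ∅),
        weightPoly x y (rowsAfter T.unrestrictedRows S) (colsAfter T.topCount S)
          (T.numRows - 1) := by
    intro T hT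
    rw [addColSum, Finset.filter_true_of_mem, Finset.sum_filter]
    · refine Finset.sum_congr rfl fun S _ => ?_
      rw [ite_not]
    · intro i hi
      have := (mem_unrestrictedRows.1 hi).1
      omega
  rw [Finset.sum_congr rfl e, Finset.sum_sigma']
  have hfull : ∀ T ∈ (PT (n + 2)).filter (fun T => ¬ T.shape.colLen 0 < T.numRows),
      T.length = n + 2 ∧ T.shape.colLen 0 = T.numRows := by
    intro T hT
    have h2 := (Finset.mem_filter.1 hT).2
    have h3 := T.colLen_le
    exact ⟨mem_PT.1 (Finset.mem_filter.1 hT).1, by omega⟩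
  have hne : ∀ T ∈ (PT (n + 2)).filter (fun T => ¬ T.shape.colLen 0 < T.numRows),
      T.firstCol.Nonempty := by
    intro T hT
    obtain ⟨h1, h2⟩ := hfull T hT
    obtain ⟨i, hi⟩ := T.exists_one 0 (numCols_pos (by omega) h2)
    exact ⟨i, mem_firstCol.2 hi⟩
  refine Finset.sum_bij' (fun T _ => ⟨T.delCol, T.firstCol⟩)
    (fun p hp => p.1.addCol p.2
      (Finset.mem_powerset.1 (Finset.mem_filter.1 (Finset.mem_sigma.1 hp).2).1)
      (Finset.nonempty_iff_ne_empty.2 (Finset.mem_filter.1 (Finset.mem_sigma.1 hp).2).2))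
    ?_ ?_ ?_ ?_ ?_
  · intro T hT
    obtain ⟨h1, h2⟩ := hfull T hT
    have h3 := numCols_pos (by omega) h2
    refine Finset.mem_sigma.2 ⟨mem_PT.2 ?_, Finset.mem_filter.2
      ⟨Finset.mem_powerset.2 T.firstCol_subset, Finset.nonempty_iff_ne_empty.1 (hne T hT)⟩⟩
    change T.numRows + T.delCol.numCols = n + 1
    rw [numCols_delCol]
    change T.numRows + T.numCols = n + 2 at h1
    omega
  · rintro ⟨T, S⟩ hp
    have hT : T.numRows + T.numCols = n + 1 := mem_PT.1 (Finset.mem_sigma.1 hp).1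
    have hSf := Finset.mem_filter.1 (Finset.mem_sigma.1 hp).2
    have hS := Finset.mem_powerset.1 hSf.1
    have hn := Finset.nonempty_iff_ne_empty.2 hSf.2
    refine Finset.mem_filter.2 ⟨mem_PT.2 ?_, by rw [colLen_addCol]; exact lt_irrefl _⟩
    have hl : 0 < (T.addCol S hS hn).length := by
      have : 0 < T.numRows := numRows_pos (by rw [length]; omega)
      exact Nat.add_pos_left this _
    have h1 := numCols_pos hl colLen_addCol
    have h2 := numCols_delCol (T.addCol S hS hn)
    rw [delCol_addCol] at h2
    change T.numRows + (T.addCol S hS hn).numCols = n + 2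
    omega
  · intro T hT
    exact addCol_delCol (hfull T hT).2 (hne T hT)
  · rintro ⟨T, S⟩ hp
    simp only [delCol_addCol, firstCol_addCol]
  · intro T hT
    exact weight_eq_of_colLen_eq x y (hfull T hT).2

open Polynomial in
theorem X_add_one_mul_sum_weight :
    (X + 1) * ∑ T ∈ PT (n + 2), T.weight x y
      = (X + C y) * (X + 1 + C x) * (∑ T ∈ PT (n + 1), T.weight x y).comp (X + 1)
        - C ((y - 1) * x * (∑ T ∈ PT (n + 1), T.weight x y).eval 0) := by
  rw [← Finset.sum_filter_add_sum_filter_not (PT (n + 2))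
    (fun T => T.shape.colLen 0 < T.numRows), sum_weight_colLen_lt, sum_weight_colLen_eq,
    ← Finset.sum_add_distrib, Finset.mul_sum, Polynomial.sum_comp, eval_finsetSum, Finset.mul_sum,
    Finset.mul_sum, map_sum, ← Finset.sum_sub_distrib]
  refine Finset.sum_congr rfl fun T hT => ?_
  have h1 : 0 < T.numRows := numRows_pos (by rw [mem_PT.1 hT]; omega)
  exact X_add_one_mul_addColSum x y _ _ (zero_mem_unrestrictedRows h1) _

theorem sum_weight_one : ∑ T ∈ PT 1, T.weight x y = 1 := by
  let T₀ : PermutationTableau :=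
    { shape := ⊥
      numRows := 1
      colLen_le := by
        by_contra! h
        exact YoungDiagram.notMem_bot _
          (YoungDiagram.mem_iff_lt_colLen.2 (zero_lt_one.trans h))
      ones := ∅
      ones_subset := Finset.empty_subset _
      exists_one := fun j hj =>
        absurd (YoungDiagram.mem_iff_lt_rowLen.2 hj) (YoungDiagram.notMem_bot _)
      not_above_and_left := fun i j h => absurd h (YoungDiagram.notMem_bot _) }
  have hcols : T₀.numCols = 0 := by
    by_contra h
    exact YoungDiagram.notMem_bot _ (T₀.lt_numCols_iff.1 (Nat.pos_of_ne_zero h))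
  have hPT : PT 1 = {T₀} := by
    ext T
    rw [mem_PT, Finset.mem_singleton]
    constructor
    · intro h
      have h1 := numRows_pos (T := T) (by omega)
      change T.numRows + T.numCols = 1 at h
      have hnot : ∀ c, c ∉ T.shape := by
        rintro ⟨i, j⟩ hc
        have := T.lt_numCols hc
        omega
      apply PermutationTableau.ext
      · refine YoungDiagram.ext (Finset.eq_empty_of_forall_notMem hnot)
      · change T.numRows = 1
        omega
      · exact Finset.eq_empty_of_forall_notMem fun c hc => hnot c (T.mem_shape_of_mem_ones hc)
    · rintro rfl
      change 1 + T₀.numCols = 1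
      omega
  have htop : T₀.topCount 0 = 0 :=
    Finset.card_eq_zero.2 (Finset.eq_empty_of_forall_notMem fun j hj =>
      absurd (mem_topCols.1 hj).2.1 (Finset.notMem_empty _))
  rw [hPT, Finset.sum_singleton]
  change weightPoly x y _ _ 0 = 1
  rw [weightPoly, htop]
  simp

theorem eval_sum_weight : (∑ T ∈ PT (n + 1), T.weight x y).eval 0
    = ∑ T ∈ PT (n + 1), x ^ (T.urr - 1) * y ^ T.urc := by
  rw [Polynomial.eval_finsetSum]
  refine Finset.sum_congr rfl fun T hT => eval_weight x y (numRows_pos ?_)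
  rw [mem_PT.1 hT]
  omega

end Sum

end PermutationTableau

/-! ### Conclusion, for functionals and for measures. -/

theorem exists_isMomentFunctional_and_map_pow_eq {R : Type*} [CommRing R] (x y : R) :
    (∃ L : Polynomial R →ₗ[R] R, IsMomentFunctional (assocLaguerre x y) L) ∧
      ∀ L : Polynomial R →ₗ[R] R, IsMomentFunctional (assocLaguerre x y) L →
        ∀ n : ℕ, L (Polynomial.X ^ n) =
          ∑ T ∈ PermutationTableau.PT (n + 1), x ^ (T.urr - 1) * y ^ T.urc := by
  obtain ⟨L₀, h₀, hmom⟩ := exists_isMomentFunctional_assocLaguerre x y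
    (A := fun n => ∑ T ∈ PermutationTableau.PT (n + 1), T.weight x y)
    (PermutationTableau.sum_weight_one x y)
    (PermutationTableau.X_add_one_mul_sum_weight x y)
  refine ⟨⟨L₀, h₀⟩, fun L hL n => ?_⟩
  rw [IsMomentFunctional.map_pow_unique hL h₀ n, hmom n, PermutationTableau.eval_sum_weight]

theorem integrable_eval_of_integrable_pow {ν : MeasureTheory.Measure ℝ}
    (h : ∀ k : ℕ, MeasureTheory.Integrable (fun x : ℝ => x ^ k) ν) (p : Polynomial ℝ) :
    MeasureTheory.Integrable (fun x => p.eval x) ν := by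
  simp only [Polynomial.eval_eq_sum_range]
  exact MeasureTheory.integrable_finsetSum _ fun k _ => (h k).const_mul _

theorem theorem4p1 :
    (∀ (R : Type*) [CommRing R] (X Y : R),
      (∃ L : Polynomial R →ₗ[R] R, IsMomentFunctional (assocLaguerre X Y) L) ∧
      ∀ L : Polynomial R →ₗ[R] R, IsMomentFunctional (assocLaguerre X Y) L →
        ∀ n : ℕ, L (Polynomial.X ^ n) =
          ∑ T ∈ PermutationTableau.PT (n + 1), X ^ (T.urr - 1) * Y ^ T.urc) ∧
    (∀ (X Y : ℝ) (ν : MeasureTheory.Measure ℝ) [MeasureTheory.IsProbabilityMeasure ν],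
      (∀ k : ℕ, MeasureTheory.Integrable (fun x : ℝ => x ^ k) ν) →
      (∀ k m : ℕ, k ≠ m →
        ∫ x, (assocLaguerre X Y k).eval x * (assocLaguerre X Y m).eval x ∂ν = 0) →
      ∀ n : ℕ, ∫ x, x ^ n ∂ν =
        ∑ T ∈ PermutationTableau.PT (n + 1), X ^ (T.urr - 1) * Y ^ T.urc) := by
  refine ⟨fun R _ X Y => exists_isMomentFunctional_and_map_pow_eq X Y, ?_⟩
  intro X Y ν _ hint horth n
  have hp := integrable_eval_of_integrable_pow hint
  -- Only integration of polynomials matters, so the measure need not be determined by its moments.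
  let L : Polynomial ℝ →ₗ[ℝ] ℝ :=
    { toFun := fun p => ∫ x, p.eval x ∂ν
      map_add' := fun p q => by
        simp only [Polynomial.eval_add]
        exact MeasureTheory.integral_add (hp p) (hp q)
      map_smul' := fun c p => by
        simp only [Polynomial.eval_smul, smul_eq_mul, RingHom.id_apply]
        exact MeasureTheory.integral_const_mul c _ }
  have hL : IsMomentFunctional (assocLaguerre X Y) L := by
    refine ⟨by simp [L], fun k m hkm => ?_⟩
    simpa [L] using horth k m hkm
  simpa [L] using (exists_isMomentFunctional_and_map_pow_eq X Y).2 L hL n
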